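/- **Selective learning.** An instance with sequence length $n$ consists of an instance space $\mathcal X$, a label space $\mathcal Y$, a loss function $\ell:\mathcal Y\times\mathcal Y\to[0,1]$, a finite nonempty model class $\mathcal F$ of functions $\mathcal X\to\mathcal Y$, equivalently the family $\mathcal L=\{\ell_f : f\in\mathcal F\}$ of functions $\ell_f(x,y)=\ell(f(x),y)$ on $\mathcal Z=\mathcal X\times\mathcal Y$, and a sequence $z\in\mathcal Z^n$, fixed in advance. "$|\mathcal L|=m$" means that $\mathcal F$ has $m$ elements whose $m$ loss functions $\ell_f$ are distinct. A (randomized) selective learning algorithm is given $n$ and the model class, and observes $z_1,z_2,\dots$ one by one. At some time $t\in\{0,\dots,n-1\}$ of its choosing, having seen only $z_1,\dots,z_t$, it must stop and choose a window length $w\in\{1,\dots,n-t\}$ and a model $\hat\ell\in\mathcal L$. Its excess risk is $$\frac1w\sum_{i=1}^w\hat\ell(z_{t+i})-\inf_{\ell\in\mathcal L}\frac1w\sum_{i=1}^w\ell(z_{t+i}).$$ The algorithm is *non-adaptive* if it decides the window (i.e. $t$ and $w$) before seeing the data sequence, using only the model class and its own randomness. Expectations are over the randomness of the algorithm. For $n\ge1$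 and $m\ge2$ put $R(n,m)=\min\left\{\frac{\max\{1,\ \log\log m\}}{\log n},\,1\right\}$, with $R(1,m)=1$ (natural logarithms). **Theorem.** There is an absolute constant $c>0$ such that the following hold. 1. For all $n\ge1$, $m\ge2$ and every non-adaptive selective learning algorithm, there is a selective learning instance with $|\mathcal L|=m$ and sequence length $n$ on which the expected excess risk of the algorithm is at least $c\,R(n,m)$. 2. Let $g:\mathbb N\to\mathbb R$ satisfy $g(n)=\omega(\log\log n)$, i.e. $g(n)/\log\log n\to+\infty$. Then there is $n_0=n_0(g)$ such that for all $n\ge \max\{n_0,1\}$, all $m\ge2$ with $m\ge n^{g(n)}$ and every (possibly adaptive) selective learning algorithm, there is an instance with $|\mathcal L|=m$ and sequence length $n$ on which the expected excess risk of the algorithm is at least $c\,R(n,m)$. Moreover, the same holds for all $n\ge1$ and $m\ge 2$ with $m\ge n^{g(n)}$, if $c$ is replaced by a constant $c'>0$ that depends only on $g$. -/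

import Mathlib

open Filter MeasureTheory

universe u

namespace SelectiveLearning

/-- A finite nonempty class of models `f : X → Y`, with a loss function valued in `[0, 1]`. -/
structure ModelClass where
  X : Type
  Y : Type
  /-- `loss yhat y` is the loss for predicting `yhat` when the true label is `y`. -/
  loss : Y → Y → ℝ
  loss_mem : ∀ yhat y, loss yhat y ∈ Set.Icc (0 : ℝ) 1
  models : Finset (X → Y)
  models_nonempty : models.Nonempty

namespace ModelClass

/-- Labeled data points. -/
abbrev Z (C : ModelClass) : Type := C.X × C.Y

/-- The function from labeled data to losses that corresponds to a model. -/
def lossOf (C : ModelClass) (f : C.X → C.Y) (p : C.Z) : ℝ := C.loss (f p.1) p.2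

/-- The model class, viewed as a family of functions from labeled data to losses. -/
def lossFamily (C : ModelClass) : Set (C.Z → ℝ) := C.lossOf '' (C.models : Set (C.X → C.Y))

/-- The class has exactly `m` elements, both as a set of models and as a family of loss
functions. -/
def HasSize (C : ModelClass) (m : ℕ) : Prop :=
  C.models.card = m ∧ C.lossFamily.ncard = m

end ModelClass

/-- A prediction window for sequences of length `n`: after the first `start` data points, the next
`len ≥ 1` data points. (With data points indexed from `0`, these are the points
`start, …, start + len - 1`.) -/
structure Window (n : ℕ) where
  start : ℕ
  len : ℕ
  len_pos : 1 ≤ len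
  le_length : start + len ≤ n

/-- The average loss of the model `f` on the data points of the window `W`. -/
noncomputable def averageLoss (C : ModelClass) {n : ℕ} (z : Fin n → C.Z) (W : Window n)
    (f : C.X → C.Y) : ℝ :=
  (∑ i : Fin W.len,
    C.lossOf f (z ⟨W.start + i, lt_of_lt_of_le (Nat.add_lt_add_left i.2 _) W.le_length⟩)) / W.len

/-- The excess risk incurred by choosing the window `W` and the model `f` on the data `z`. -/
noncomputable def excessRisk (C : ModelClass) {n : ℕ} (z : Fin n → C.Z) (W : Window n)
    (f : C.X → C.Y) : ℝ :=
  averageLoss C z W f - ⨅ g : {g // g ∈ C.models}, averageLoss C z W g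

/-- A (randomized) selective learner for the model class `C` and sequences of length `n`.
The randomness of the learner is a seed `ω`, drawn from a probability space independently of the
data. Given the seed, on the data sequence `z`, the learner stops after the first
`(window ω z).start` data points, and commits to the window `window ω z` and the
model `model ω z` of the class. -/
structure Learner (C : ModelClass) (n : ℕ) where
  Seed : Type u
  [measurableSpace : MeasurableSpace Seed]
  law : Measure Seed
  [isProbabilityMeasure : IsProbabilityMeasure law]
  window : Seed → (Fin n → C.Z) → Window n
  model : Seed → (Fin n → C.Z) → {f // f ∈ C.models}
  /-- The learner sees the data points one by one: its stopping at time `t`, and its action at that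
  time, depend on the first `t` data points only. -/
  online : ∀ (ω : Seed) (z z' : Fin n → C.Z),
    (∀ i : Fin n, (i : ℕ) < (window ω z).start → z' i = z i) →
      window ω z' = window ω z ∧ model ω z' = model ω z
  measurableSet_action : ∀ (z : Fin n → C.Z) (W : Window n) (f : {f // f ∈ C.models}),
    MeasurableSet {ω | window ω z = W ∧ model ω z = f}

namespace Learner

variable {C : ModelClass} {n : ℕ}

/-- The learner decides the prediction window before seeing the data (from its seed alone). -/
def IsNonAdaptive (A : Learner.{u} C n) : Prop :=
  ∀ (ω : A.Seed) (z z' : Fin n → C.Z), A.window ω z = A.window ω z'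

/-- The expected excess risk of the learner on the fixed data sequence `z`. -/
noncomputable def expectedExcessRisk (A : Learner.{u} C n) (z : Fin n → C.Z) : ℝ :=
  letI := A.measurableSpace
  ∫ ω, excessRisk C z (A.window ω z) (A.model ω z) ∂A.law

end Learner

/-- A selective learning algorithm for sequences of length `n`: it takes a model class as its
input, and then runs as a selective learner for that class. -/
def Algorithm (n : ℕ) : Type (max 1 (u + 1)) := ∀ C : ModelClass, Learner.{u} C n

/-- On every model class, the algorithm decides the prediction window before seeing the data. -/
def Algorithm.IsNonAdaptive {n : ℕ} (A : Algorithm.{u} n) : Prop :=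
  ∀ C : ModelClass, (A C).IsNonAdaptive

/-- `min {log log m / log n, 1}`, where `log log m` is replaced by `1` if it is smaller than `1`,
and where the quotient counts as `+∞` if `n = 1`. -/
noncomputable def rate (n m : ℕ) : ℝ :=
  if n = 1 then 1 else min (max 1 (Real.log (Real.log m)) / Real.log n) 1

/-- There is an instance (a model class of size `m` and a data sequence of length `n`) on which
the expected excess risk of the algorithm is at least `r`. -/
def Algorithm.HasHardInstance {n : ℕ} (A : Algorithm.{u} n) (m : ℕ) (r : ℝ) : Prop :=
  ∃ C : ModelClass, C.HasSize m ∧ ∃ z : Fin n → C.Z, r ≤ (A C).expectedExcessRisk z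

end SelectiveLearning

/-!
The labels are coin flips that are constant on blocks of consecutive points, and the number modulo
`D` of the block of each point is observed in advance. Flipping the labels of all blocks that the
learner has not seen when it stops does not change its action, so that on unseen blocks it makes one
mistake per point in total on the two labelings. If most points of its window lie in at most `D`
consecutive unseen blocks, some function of the number modulo `D` makes few mistakes on either
labeling, so the learner has excess risk of constant order on one of them. For every window this
happens for blocks of one of about `log n / log D` geometrically growing lengths, in one of eight
shifted positions.

A non-adaptive learner is confronted with a random length and position; the class then needs `2 ^ D`
models, so `D` is of order `log m`. An adaptive learner could recognise the length from the labels.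
It is confronted with all lengths and positions at once, in parallel channels whose mistakes are
averaged. The model it is compared to handles one channel as above and is constant on each other
channel. A constant can match the learner there, since the seen part of the window lies in a single
block, and this adds only a factor exponential in the number of channels to the size of the class.
-/

namespace SelectiveLearning

section Averaging

variable {C : ModelClass} {n : ℕ}

theorem Window.start_lt (W : Window n) : W.start < n :=
  (Nat.lt_add_of_pos_right W.len_pos).trans_le W.le_length

instance : Finite (Window n) := by
  refine Finite.of_injective (β := Fin n × Fin (n + 1))
    (fun W => (⟨W.start, W.start_lt⟩,
      ⟨W.len, Nat.lt_succ_of_le ((Nat.le_add_left _ _).trans W.le_length)⟩)) ?_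
  rintro ⟨a, b, _, _⟩ ⟨c, d, _, _⟩ h
  simp only [Prod.mk.injEq, Fin.mk.injEq] at h
  obtain ⟨rfl, rfl⟩ := h
  rfl

theorem averageLoss_sub_averageLoss_le_excessRisk (z : Fin n → C.Z) (W : Window n)
    (f : C.X → C.Y) {g : C.X → C.Y} (hg : g ∈ C.models) :
    averageLoss C z W f - averageLoss C z W g ≤ excessRisk C z W f :=
  sub_le_sub_left
    (ciInf_le (f := fun g : {g // g ∈ C.models} => averageLoss C z W g)
      (Set.finite_range _).bddBelow ⟨g, hg⟩) _

theorem excessRisk_nonneg (z : Fin n → C.Z) (W : Window n) {f : C.X → C.Y}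
    (hf : f ∈ C.models) : 0 ≤ excessRisk C z W f := by
  simpa using averageLoss_sub_averageLoss_le_excessRisk z W f hf

namespace Learner

/-- The excess risk on the data `z` of the learner whose seed is `ω`. -/
noncomputable def risk (A : Learner.{u} C n) (ω : A.Seed) (z : Fin n → C.Z) : ℝ :=
  excessRisk C z (A.window ω z) (A.model ω z)

theorem risk_nonneg (A : Learner.{u} C n) (ω : A.Seed) (z : Fin n → C.Z) : 0 ≤ A.risk ω z :=
  excessRisk_nonneg _ _ (A.model ω z).2

theorem nonempty_seed (A : Learner.{u} C n) : Nonempty A.Seed :=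
  letI := A.measurableSpace
  haveI := A.isProbabilityMeasure
  nonempty_of_isProbabilityMeasure A.law

theorem integrable_risk (A : Learner.{u} C n) (z : Fin n → C.Z) :
    letI := A.measurableSpace
    Integrable (fun ω => A.risk ω z) A.law := by
  let _ := A.measurableSpace
  have := A.isProbabilityMeasure
  let action (ω : A.Seed) : Window n × {f // f ∈ C.models} := (A.window ω z, A.model ω z)
  let riskOf (a : Window n × {f // f ∈ C.models}) : ℝ := excessRisk C z a.1 a.2
  let _ : MeasurableSpace (Window n × {f // f ∈ C.models}) := ⊤
  have measurable_action : Measurable action := by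
    refine measurable_to_countable' fun a => ?_
    have : action ⁻¹' {a} = {ω | A.window ω z = a.1 ∧ A.model ω z = a.2} := by
      ext ω
      simp [action, Prod.ext_iff]
    exact this ▸ A.measurableSet_action z a.1 a.2
  obtain ⟨b, hb⟩ := (Set.finite_range fun a => ‖riskOf a‖).bddAbove
  exact Integrable.of_bound
    ((measurable_from_top (f := riskOf)).comp measurable_action).aestronglyMeasurable b
    (ae_of_all _ fun ω => hb ⟨action ω, rfl⟩)

theorem exists_le_expectedExcessRisk (A : Learner.{u} C n) {ι : Type*} [Fintype ι] [Nonempty ι]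
    (z : ι → Fin n → C.Z) {r : ℝ} (h : ∀ ω, Fintype.card ι * r ≤ ∑ i, A.risk ω (z i)) :
    ∃ i, r ≤ A.expectedExcessRisk (z i) := by
  let _ := A.measurableSpace
  have := A.isProbabilityMeasure
  have sum_const_le : ∑ _i : ι, r ≤ ∑ i, A.expectedExcessRisk (z i) := calc
    ∑ _i : ι, r = ∫ _, Fintype.card ι * r ∂A.law := by simp
    _ ≤ ∫ ω, ∑ i, A.risk ω (z i) ∂A.law :=
      integral_mono (integrable_const _)
        (integrable_finsetSum _ fun i _ => A.integrable_risk (z i)) h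
    _ = ∑ i, A.expectedExcessRisk (z i) :=
      integral_finsetSum _ fun i _ => A.integrable_risk (z i)
  obtain ⟨i, -, hi⟩ := Finset.exists_le_of_sum_le Finset.univ_nonempty sum_const_le
  exact ⟨i, hi⟩

end Learner

end Averaging

section Channels

variable {σ : Type} [Fintype σ]

/-- The fraction of the channels `σ` on which two vectors of bits differ. -/
noncomputable def hammingLoss (a b : σ → Bool) : ℝ := hammingDist a b / Fintype.card σ

theorem hammingLoss_mem_Icc (a b : σ → Bool) : hammingLoss a b ∈ Set.Icc (0 : ℝ) 1 :=
  ⟨by unfold hammingLoss; positivity,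
    div_le_one_of_le₀ (mod_cast hammingDist_le_card_fintype) (Nat.cast_nonneg _)⟩

theorem hammingLoss_eq_zero {a b : σ → Bool} : hammingLoss a b = 0 ↔ a = b := by
  simpa [hammingLoss, Fintype.card_eq_zero_iff] using fun _ : IsEmpty σ => Subsingleton.elim a b

/-- The model that predicts each channel from the corresponding coordinate alone. -/
def channelwise (F : σ → ℕ → Bool) (x : σ → ℕ) (s : σ) : Bool := F s (x s)

omit [Fintype σ] in
theorem channelwise_injective : Function.Injective (channelwise (σ := σ)) := fun _ _ h =>
  funext₂ fun s k => congrFun₂ h (fun _ => k) s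

/-- The class of the channelwise models given by a finite set of predictors, with the Hamming
loss. -/
noncomputable abbrev channelClass (T : Finset (σ → ℕ → Bool)) (hT : T.Nonempty) :
    ModelClass where
  X := σ → ℕ
  Y := σ → Bool
  loss := hammingLoss
  loss_mem := hammingLoss_mem_Icc
  models := T.map ⟨channelwise, channelwise_injective⟩
  models_nonempty := hT.map

theorem hasSize_channelClass (T : Finset (σ → ℕ → Bool)) (hT : T.Nonempty) :
    (channelClass T hT).HasSize T.card := by
  have lossOf_injective : Function.Injective (channelClass T hT).lossOf := fun f g h =>
    funext fun x => hammingLoss_eq_zero.1 <|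
      (congrFun h (x, g x)).trans (hammingLoss_eq_zero.2 rfl)
  refine ⟨Finset.card_map _, ?_⟩
  rw [ModelClass.lossFamily, Set.ncard_image_of_injective _ lossOf_injective,
    Set.ncard_coe_finset, Finset.card_map]

variable [DecidableEq σ]

/-- The predictor that answers by membership in `P` on the channel `s`, and by a constant on each
of the other channels. -/
def comparator (s : σ) (P : Finset ℕ) (q : {j // j ≠ s} → Bool) (j : σ) (k : ℕ) : Bool :=
  if h : j = s then decide (k ∈ P) else q ⟨j, h⟩

variable (σ) in
open Classical in
/-- All the comparators with a set of keys less than `D`. -/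
noncomputable def comparators (D : ℕ) : Finset (σ → ℕ → Bool) :=
  Finset.univ.biUnion fun s =>
    ((Finset.range D).powerset ×ˢ Finset.univ).image fun a => comparator s a.1 a.2

theorem comparator_mem_comparators {D : ℕ} (s : σ) {P : Finset ℕ} (hP : P ⊆ Finset.range D)
    (q : {j // j ≠ s} → Bool) : comparator s P q ∈ comparators σ D := by
  classical
  exact Finset.mem_biUnion.2 ⟨s, Finset.mem_univ s, Finset.mem_image.2
    ⟨(P, q), Finset.mk_mem_product (Finset.mem_powerset.2 hP) (Finset.mem_univ q), rfl⟩⟩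

variable (σ) in
theorem card_comparators_le (D : ℕ) :
    (comparators σ D).card ≤ Fintype.card σ * (2 ^ D * 2 ^ (Fintype.card σ - 1)) := by
  classical
  refine Finset.card_biUnion_le_card_mul _ _ _ fun s _ => Finset.card_image_le.trans_eq ?_
  simp [Finset.card_product, Fintype.card_subtype_compl]

theorem exists_superset_comparators [Nonempty σ] {D m : ℕ}
    (hm : Fintype.card σ * (2 ^ D * 2 ^ (Fintype.card σ - 1)) ≤ m) :
    ∃ T : Finset (σ → ℕ → Bool), T.Nonempty ∧ comparators σ D ⊆ T ∧ T.card = m := by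
  obtain ⟨T, hT, hcard⟩ :=
    Infinite.exists_superset_card_eq (comparators σ D) m ((card_comparators_le σ D).trans hm)
  have comparators_nonempty : (comparators σ D).Nonempty :=
    ⟨_, comparator_mem_comparators (Classical.arbitrary σ) (Finset.empty_subset _) fun _ => false⟩
  exact ⟨T, comparators_nonempty.mono hT, hT, hcard⟩

end Channels

section Blocks

variable {n D : ℕ} {blk : Fin n → Fin n} {W : Window n}

/-- The `i`-th data point of the window `W`. -/
def Window.pos (W : Window n) (i : Fin W.len) : Fin n :=
  ⟨W.start + i, lt_of_lt_of_le (Nat.add_lt_add_left i.2 _) W.le_length⟩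

@[simp]
theorem Window.val_pos (W : Window n) (i : Fin W.len) : (W.pos i : ℕ) = W.start + i :=
  rfl

/-- The blocks that meet the first `t` data points, where `blk i` is the block of the data
point `i`. -/
def seenBlocks (blk : Fin n → Fin n) (t : ℕ) : Finset (Fin n) :=
  ({i : Fin n | (i : ℕ) < t} : Finset (Fin n)).image blk

theorem apply_mem_seenBlocks {t : ℕ} {i : Fin n} (hi : (i : ℕ) < t) : blk i ∈ seenBlocks blk t :=
  Finset.mem_image_of_mem _ (by simpa using hi)

/-- Flip the labels of the blocks that do not meet the first `t` data points. -/
def flipUnseen (blk : Fin n → Fin n) (t : ℕ) (B : Fin n → Bool) (k : Fin n) : Bool :=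
  if k ∈ seenBlocks blk t then B k else !B k

theorem flipUnseen_of_mem {t : ℕ} {k : Fin n} (hk : k ∈ seenBlocks blk t) (B : Fin n → Bool) :
    flipUnseen blk t B k = B k :=
  if_pos hk

theorem flipUnseen_of_notMem {t : ℕ} {k : Fin n} (hk : k ∉ seenBlocks blk t) (B : Fin n → Bool) :
    flipUnseen blk t B k = !B k :=
  if_neg hk

theorem flipUnseen_flipUnseen (blk : Fin n → Fin n) (t : ℕ) (B : Fin n → Bool) :
    flipUnseen blk t (flipUnseen blk t B) = B := by
  funext k
  by_cases hk : k ∈ seenBlocks blk t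
  · rw [flipUnseen_of_mem hk, flipUnseen_of_mem hk]
  · rw [flipUnseen_of_notMem hk, flipUnseen_of_notMem hk, Bool.not_not]

/-- A window is challenging if, on three quarters of its points, the labels of the blocks are yet
unseen and can be predicted in hindsight from the number of the block modulo `D`. -/
def Window.Challenging (D : ℕ) (blk : Fin n → Fin n) (W : Window n) : Prop :=
  ∃ G : Finset (Fin W.len), 4 * Gᶜ.card ≤ W.len ∧
    (∀ i ∈ G, blk (W.pos i) ∉ seenBlocks blk W.start) ∧
    ∀ i ∈ G, ∀ j ∈ G, (blk (W.pos i) : ℕ) % D = blk (W.pos j) % D → blk (W.pos i) = blk (W.pos j)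

/-- The number of mistakes in the window `W` of the predictor `f`, which sees the number of a block
modulo `D`, if `B` gives the labels of the blocks. -/
def mistakes (D : ℕ) (blk : Fin n → Fin n) (W : Window n) (B : Fin n → Bool) (f : ℕ → Bool) : ℕ :=
  hammingDist (fun i : Fin W.len => f (blk (W.pos i) % D)) fun i => B (blk (W.pos i))

theorem len_le_mistakes_add_mistakes_flipUnseen {G : Finset (Fin W.len)}
    (hG : ∀ i ∈ G, blk (W.pos i) ∉ seenBlocks blk W.start) (B : Fin n → Bool) (f : ℕ → Bool) :
    W.len ≤ mistakes D blk W B f + mistakes D blk W (flipUnseen blk W.start B) f + Gᶜ.card := by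
  have card_le : G.card ≤ hammingDist (fun i : Fin W.len => B (blk (W.pos i)))
      fun i => flipUnseen blk W.start B (blk (W.pos i)) :=
    Finset.card_le_card fun i hi => by simp [flipUnseen_of_notMem (hG i hi)]
  calc W.len = G.card + Gᶜ.card := by rw [Finset.card_add_card_compl, Fintype.card_fin]
    _ ≤ mistakes D blk W B f + mistakes D blk W (flipUnseen blk W.start B) f + Gᶜ.card := by
      gcongr
      exact card_le.trans (hammingDist_triangle_left _ _ _)

theorem exists_mistakes_le_card_compl (hD : 0 < D) {G : Finset (Fin W.len)}
    (hG : ∀ i ∈ G, ∀ j ∈ G, (blk (W.pos i) : ℕ) % D = blk (W.pos j) % D →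
      blk (W.pos i) = blk (W.pos j)) (B : Fin n → Bool) :
    ∃ P ⊆ Finset.range D, mistakes D blk W B (fun k => decide (k ∈ P)) ≤ Gᶜ.card := by
  refine ⟨{i ∈ G | B (blk (W.pos i)) = true}.image fun i => (blk (W.pos i) : ℕ) % D, ?_, ?_⟩
  · exact Finset.image_subset_iff.2 fun i _ => Finset.mem_range.2 (Nat.mod_lt _ hD)
  · unfold mistakes hammingDist
    refine Finset.card_le_card fun i hi => Finset.mem_compl.2 fun hiG => ?_
    refine (Finset.mem_filter.1 hi).2 (Bool.eq_iff_iff.2 ?_)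
    simp only [decide_eq_true_iff, Finset.mem_image, Finset.mem_filter]
    constructor
    · rintro ⟨j, ⟨hj, hB⟩, hji⟩
      rwa [← hG j hj i hiG hji]
    · exact fun hB => ⟨i, ⟨hiG, hB⟩, rfl⟩

theorem blk_pos_eq_of_mem_seenBlocks (hblk : Monotone blk) {i : Fin W.len}
    (hi : blk (W.pos i) ∈ seenBlocks blk W.start) :
    blk (W.pos i) = blk (W.pos ⟨0, W.len_pos⟩) := by
  obtain ⟨j, hj, hji⟩ := Finset.mem_image.1 hi
  refine le_antisymm (hji ▸ hblk ?_) (hblk ?_)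
  · simp [Fin.le_def]
  · have hj : (j : ℕ) < W.start := by simpa using hj
    simpa [Fin.le_def] using hj.le

-- An unseen block contributes one mistake in total to the two labelings, whatever is predicted, and
-- a seen block that meets the window contains its first point.
theorem mistakes_add_mistakes_flipUnseen_eq_const (hblk : Monotone blk) (B : Fin n → Bool)
    (f : ℕ → Bool) :
    mistakes D blk W B f + mistakes D blk W (flipUnseen blk W.start B) f =
      mistakes D blk W B (fun _ => f (blk (W.pos ⟨0, W.len_pos⟩) % D)) +
        mistakes D blk W (flipUnseen blk W.start B)
          (fun _ => f (blk (W.pos ⟨0, W.len_pos⟩) % D)) := by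
  simp only [mistakes, hammingDist, Finset.card_filter, ← Finset.sum_add_distrib]
  refine Finset.sum_congr rfl fun i _ => ?_
  by_cases hi : blk (W.pos i) ∈ seenBlocks blk W.start
  · rw [blk_pos_eq_of_mem_seenBlocks hblk hi]
  · have add_not (a b : Bool) : ((if a ≠ b then 1 else 0) + if a ≠ !b then 1 else 0) = 1 := by
      cases a <;> cases b <;> rfl
    simp only [flipUnseen_of_notMem hi, add_not]

end Blocks

section Scenarios

variable {σ : Type} {n D : ℕ}

/-- On each channel, the data come in blocks: the number modulo `D` of the block of a data point is
observed in advance, and all points of the block `k` share the label `B s k`. -/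
def blockData (D : ℕ) (blk : σ → Fin n → Fin n) (B : σ → Fin n → Bool) (i : Fin n) :
    (σ → ℕ) × (σ → Bool) :=
  (fun s => blk s i % D, fun s => B s (blk s i))

theorem blockData_flipUnseen (D : ℕ) (blk : σ → Fin n → Fin n) {t : ℕ} (B : σ → Fin n → Bool)
    {i : Fin n} (hi : (i : ℕ) < t) :
    blockData D blk (fun s => flipUnseen (blk s) t (B s)) i = blockData D blk B i :=
  Prod.ext rfl (funext fun s => flipUnseen_of_mem (apply_mem_seenBlocks hi) (B s))

variable [Fintype σ]

theorem averageLoss_channelClass {T : Finset (σ → ℕ → Bool)} (hT : T.Nonempty) (D : ℕ)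
    (blk : σ → Fin n → Fin n) (B : σ → Fin n → Bool) (W : Window n) (F : σ → ℕ → Bool) :
    averageLoss (channelClass T hT) (blockData D blk B) W (channelwise F) =
      (∑ s, mistakes D (blk s) W (B s) (F s) : ℕ) / (Fintype.card σ * W.len) := by
  have double_count : ∑ s, mistakes D (blk s) W (B s) (F s) = ∑ i : Fin W.len,
      hammingDist (fun s => F s (blk s (W.pos i) % D)) fun s => B s (blk s (W.pos i)) := by
    simp only [mistakes, hammingDist, Finset.card_filter]
    exact Finset.sum_comm
  rw [double_count, Nat.cast_sum, ← div_div, Finset.sum_div]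
  rfl

variable [DecidableEq σ]

theorem exists_comparators_mistakes_le (hD : 0 < D) {blk : σ → Fin n → Fin n}
    (hblk : ∀ s, Monotone (blk s)) {W : Window n} {s : σ} (hW : W.Challenging D (blk s))
    (B : σ → Fin n → Bool) (F : σ → ℕ → Bool) :
    ∃ F₁ ∈ comparators σ D, ∃ F₂ ∈ comparators σ D,
      W.len + 4 * ∑ j, (mistakes D (blk j) W (B j) (F₁ j) +
          mistakes D (blk j) W (flipUnseen (blk j) W.start (B j)) (F₂ j)) ≤
        4 * ∑ j, (mistakes D (blk j) W (B j) (F j) +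
          mistakes D (blk j) W (flipUnseen (blk j) W.start (B j)) (F j)) := by
  obtain ⟨G, hcard, hunseen, hkeys⟩ := hW
  obtain ⟨P₁, hP₁, hmist₁⟩ := exists_mistakes_le_card_compl hD hkeys (B s)
  obtain ⟨P₂, hP₂, hmist₂⟩ :=
    exists_mistakes_le_card_compl hD hkeys (flipUnseen (blk s) W.start (B s))
  let q (j : {j // j ≠ s}) : Bool := F j (blk j (W.pos ⟨0, W.len_pos⟩) % D)
  refine ⟨comparator s P₁ q, comparator_mem_comparators s hP₁ q,
    comparator s P₂ q, comparator_mem_comparators s hP₂ q, ?_⟩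
  have on_channel (P : Finset ℕ) : comparator s P q s = fun k => decide (k ∈ P) :=
    funext fun k => dif_pos rfl
  have off_channel (P : Finset ℕ) {j : σ} (hj : j ≠ s) :
      comparator s P q j = fun _ => F j (blk j (W.pos ⟨0, W.len_pos⟩) % D) :=
    funext fun k => dif_neg hj
  have channel_le (j : σ) : (if j = s then W.len else 0) +
      4 * (mistakes D (blk j) W (B j) (comparator s P₁ q j) +
        mistakes D (blk j) W (flipUnseen (blk j) W.start (B j)) (comparator s P₂ q j)) ≤
      4 * (mistakes D (blk j) W (B j) (F j) +
        mistakes D (blk j) W (flipUnseen (blk j) W.start (B j)) (F j)) := by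
    rcases eq_or_ne j s with rfl | hj
    · have := len_le_mistakes_add_mistakes_flipUnseen (D := D) hunseen (B j) (F j)
      rw [if_pos rfl, on_channel, on_channel]
      omega
    · rw [if_neg hj, off_channel P₁ hj, off_channel P₂ hj, zero_add,
        mistakes_add_mistakes_flipUnseen_eq_const (hblk j) (B j) (F j)]
  simpa only [Finset.sum_add_distrib, Finset.sum_ite_eq', Finset.mem_univ, if_true,
    ← Finset.mul_sum] using Finset.sum_le_sum fun j (_ : j ∈ Finset.univ) => channel_le j

theorem le_excessRisk_add_excessRisk_flipUnseen {T : Finset (σ → ℕ → Bool)} (hT : T.Nonempty)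
    (hD : 0 < D) (hTD : comparators σ D ⊆ T) {blk : σ → Fin n → Fin n}
    (hblk : ∀ s, Monotone (blk s)) {W : Window n} {s : σ} (hW : W.Challenging D (blk s))
    (B : σ → Fin n → Bool) (F : σ → ℕ → Bool) :
    1 / (4 * Fintype.card σ : ℝ) ≤
      excessRisk (channelClass T hT) (blockData D blk B) W (channelwise F) +
      excessRisk (channelClass T hT)
        (blockData D blk fun j => flipUnseen (blk j) W.start (B j)) W (channelwise F) := by
  obtain ⟨F₁, hF₁, F₂, hF₂, hcomp⟩ := exists_comparators_mistakes_le hD hblk hW B F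
  have mem_models {F' : σ → ℕ → Bool} (h : F' ∈ comparators σ D) :
      channelwise F' ∈ (channelClass T hT).models := Finset.mem_map_of_mem _ (hTD h)
  refine le_trans ?_ <| add_le_add
    (averageLoss_sub_averageLoss_le_excessRisk (C := channelClass T hT) _ W _ (mem_models hF₁))
    (averageLoss_sub_averageLoss_le_excessRisk (C := channelClass T hT) _ W _ (mem_models hF₂))
  simp only [averageLoss_channelClass]
  have hσ : (0 : ℝ) < Fintype.card σ := mod_cast Fintype.card_pos_iff.2 ⟨s⟩
  have hlen : (0 : ℝ) < W.len := mod_cast W.len_pos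
  rw [← sub_div, ← sub_div, ← add_div, div_le_div_iff₀ (by positivity) (by positivity)]
  rw [Finset.sum_add_distrib, Finset.sum_add_distrib] at hcomp
  have hcomp := mul_le_mul_of_nonneg_left (Nat.cast_le (α := ℝ).2 hcomp) hσ.le
  push_cast at hcomp ⊢
  linarith

/-- The labelings on which the learner with seed `ω` chooses a window that is challenging on some
channel. -/
def Learner.challenged {T : Finset (σ → ℕ → Bool)} {hT : T.Nonempty}
    (A : Learner.{u} (channelClass T hT) n) (ω : A.Seed) (D : ℕ) (blk : σ → Fin n → Fin n) :
    Set (σ → Fin n → Bool) :=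
  {B | ∃ s, (A.window ω (blockData D blk B)).Challenging D (blk s)}

open Classical in
theorem Learner.card_challenged_le_sum_risk {T : Finset (σ → ℕ → Bool)} {hT : T.Nonempty}
    (hD : 0 < D) (hTD : comparators σ D ⊆ T) {blk : σ → Fin n → Fin n}
    (hblk : ∀ s, Monotone (blk s)) (A : Learner.{u} (channelClass T hT) n) (ω : A.Seed) :
    (Finset.card {B | B ∈ A.challenged ω D blk} : ℝ) * (1 / (8 * Fintype.card σ)) ≤
      ∑ B, A.risk ω (blockData D blk B) := by
  let flip (B : σ → Fin n → Bool) (s : σ) : Fin n → Bool :=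
    flipUnseen (blk s) (A.window ω (blockData D blk B)).start (B s)
  have same_action (B : σ → Fin n → Bool) :
      A.window ω (blockData D blk (flip B)) = A.window ω (blockData D blk B) ∧
      A.model ω (blockData D blk (flip B)) = A.model ω (blockData D blk B) :=
    A.online ω _ _ fun _ hi => blockData_flipUnseen D blk B hi
  have flip_involutive : Function.Involutive flip := fun B => funext fun s => by
    change flipUnseen _ (A.window ω (blockData D blk (flip B))).start (flip B s) = B s
    rw [(same_action B).1]
    exact flipUnseen_flipUnseen _ _ _
  have pair_le (B : σ → Fin n → Bool) :
      (if B ∈ A.challenged ω D blk then 1 / (4 * Fintype.card σ : ℝ) else 0) ≤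
        A.risk ω (blockData D blk B) + A.risk ω (blockData D blk (flip B)) := by
    split_ifs with hB
    · obtain ⟨s, hs⟩ := hB
      obtain ⟨F, -, hF⟩ := Finset.mem_map.1 (A.model ω (blockData D blk B)).2
      rw [Learner.risk, Learner.risk, (same_action B).1, (same_action B).2, ← hF]
      exact le_excessRisk_add_excessRisk_flipUnseen hT hD hTD hblk hs B F
    · exact add_nonneg (A.risk_nonneg ω _) (A.risk_nonneg ω _)
  have sum_flip : ∑ B, A.risk ω (blockData D blk (flip B)) = ∑ B, A.risk ω (blockData D blk B) :=
    Equiv.sum_comp flip_involutive.toPerm fun B => A.risk ω (blockData D blk B)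
  have sum_le := Finset.sum_le_sum fun B (_ : B ∈ Finset.univ) => pair_le B
  rw [Finset.sum_add_distrib, sum_flip, ← Finset.sum_filter, Finset.sum_const,
    nsmul_eq_mul] at sum_le
  have halve : (1 / (4 * Fintype.card σ : ℝ)) = 2 * (1 / (8 * Fintype.card σ)) := by ring
  rw [halve] at sum_le
  linarith

theorem Learner.exists_le_expectedExcessRisk_of_challenging {ι : Type*} [Fintype ι]
    {T : Finset (σ → ℕ → Bool)} {hT : T.Nonempty} (hD : 0 < D) (hTD : comparators σ D ⊆ T)
    {blk : ι → σ → Fin n → Fin n} (hblk : ∀ p s, Monotone (blk p s))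
    (A : Learner.{u} (channelClass T hT) n) (hA : ∀ ω B, ∃ p, B ∈ A.challenged ω D (blk p)) :
    ∃ z, 1 / (8 * Fintype.card σ * Fintype.card ι) ≤ A.expectedExcessRisk z := by
  classical
  obtain ⟨ω₀⟩ := A.nonempty_seed
  have : Nonempty ι := (hA ω₀ fun _ _ => false).nonempty
  let z (a : ι × (σ → Fin n → Bool)) : Fin n → (channelClass T hT).Z := blockData D (blk a.1) a.2
  suffices h : ∀ ω, Fintype.card (ι × (σ → Fin n → Bool)) *
      (1 / (8 * Fintype.card σ * Fintype.card ι) : ℝ) ≤ ∑ a, A.risk ω (z a) from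
    (A.exists_le_expectedExcessRisk z h).imp' z fun _ => id
  intro ω
  have card_le : Fintype.card (σ → Fin n → Bool) ≤
      ∑ p, Finset.card {B | B ∈ A.challenged ω D (blk p)} := calc
    Fintype.card (σ → Fin n → Bool)
      = (Finset.univ.biUnion fun p => {B | B ∈ A.challenged ω D (blk p)}).card := by
        rw [← Finset.card_univ]
        congr 1
        ext B
        simpa using hA ω B
    _ ≤ _ := Finset.card_biUnion_le
  calc (Fintype.card (ι × (σ → Fin n → Bool)) : ℝ) * (1 / (8 * Fintype.card σ * Fintype.card ι))
      = Fintype.card (σ → Fin n → Bool) * (1 / (8 * Fintype.card σ)) := by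
        rw [Fintype.card_prod]
        push_cast
        field_simp
    _ ≤ (∑ p, Finset.card {B | B ∈ A.challenged ω D (blk p)} : ℕ) * (1 / (8 * Fintype.card σ)) := by
        exact mul_le_mul_of_nonneg_right (mod_cast card_le) (by positivity)
    _ = ∑ p, (Finset.card {B | B ∈ A.challenged ω D (blk p)} : ℝ) * (1 / (8 * Fintype.card σ)) := by
        rw [Nat.cast_sum, Finset.sum_mul]
    _ ≤ ∑ p, ∑ B, A.risk ω (blockData D (blk p) B) :=
        Finset.sum_le_sum fun p _ => A.card_challenged_le_sum_risk hD hTD (hblk p) ω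
    _ = ∑ a, A.risk ω (z a) := (Fintype.sum_prod_type fun a => A.risk ω (z a)).symm

end Scenarios

section Scales

variable {n : ℕ}

/-- Blocks of length `8 * β`, shifted to the left by `o * β`. -/
def shiftedBlock (β : ℕ) (o : Fin 8) (i : Fin n) : Fin n :=
  ⟨(i + o * β) / (8 * β), by
    rcases β.eq_zero_or_pos with rfl | hβ
    · simpa using i.pos
    · refine lt_of_le_of_lt (Nat.lt_succ_iff.1 ?_) i.2
      rw [Nat.div_lt_iff_lt_mul (by positivity)]
      nlinarith [Nat.mul_le_mul_right β o.is_le, Nat.le_mul_of_pos_right (i : ℕ) hβ]⟩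

theorem monotone_shiftedBlock (β : ℕ) (o : Fin 8) :
    Monotone (shiftedBlock β o : Fin n → Fin n) := fun _ _ hij =>
  Nat.div_le_div_right (Nat.add_le_add_right hij _)

theorem shiftedBlock_lt_iff {β : ℕ} (hβ : 0 < β) {o : Fin 8} {i : Fin n} {c : ℕ} :
    (shiftedBlock β o i : ℕ) < c ↔ (i + o * β : ℕ) < 8 * β * c := by
  rw [shiftedBlock, Nat.div_lt_iff_lt_mul (by positivity), mul_comm c]

theorem Window.challenging_shiftedBlock {β D τ : ℕ} {o : Fin 8} {W : Window n} (hβ : 0 < β)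
    (hboundary : 8 * β ∣ τ + o * β) (hstart : W.start ≤ τ) (hquarter : 4 * (τ - W.start) ≤ W.len)
    (hend : W.start + W.len ≤ τ + 8 * β * D) : W.Challenging D (shiftedBlock β o) := by
  obtain ⟨c, hc⟩ := hboundary
  have le_block {i : Fin n} (hi : τ ≤ i) : c ≤ (shiftedBlock β o i : ℕ) :=
    not_lt.1 fun h => by
      rw [shiftedBlock_lt_iff hβ] at h
      omega
  have block_lt (i : Fin W.len) : (shiftedBlock β o (W.pos i) : ℕ) < c + D := by
    rw [shiftedBlock_lt_iff hβ, mul_add, ← hc, Window.val_pos]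
    omega
  refine ⟨Finset.univ.filter fun i => τ ≤ W.pos i, ?_, fun i hi hseen => ?_,
    fun i hi j hj hij => Fin.ext ?_⟩
  · have compl_eq : ({i | τ ≤ W.pos i} : Finset (Fin W.len))ᶜ =
        ({i | (i : ℕ) < τ - W.start} : Finset (Fin W.len)) := by
      ext i
      rw [Finset.mem_compl, Finset.mem_filter_univ, Finset.mem_filter_univ, Window.val_pos]
      omega
    rw [compl_eq, Fin.card_filter_val_lt]
    omega
  · obtain ⟨j, hj, hji⟩ := Finset.mem_image.1 hseen
    have hj : (j : ℕ) < W.start := by simpa using hj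
    have hi : c ≤ (shiftedBlock β o (W.pos i) : ℕ) := le_block ((Finset.mem_filter_univ i).1 hi)
    rw [← hji, ← not_lt, shiftedBlock_lt_iff hβ] at hi
    omega
  · have hi := le_block ((Finset.mem_filter_univ i).1 hi)
    have hj := le_block ((Finset.mem_filter_univ j).1 hj)
    refine Nat.ModEq.eq_of_abs_lt hij (abs_lt.2 ?_)
    have := block_lt i
    have := block_lt j
    omega

theorem exists_boundary {β : ℕ} (hβ : 0 < β) (t : ℕ) :
    ∃ τ, ∃ o : Fin 8, t ≤ τ ∧ τ < t + β ∧ 8 * β ∣ τ + o * β := by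
  obtain ⟨c, hc⟩ : ∃ c, c = (t + β - 1) / β := ⟨_, rfl⟩
  have := Nat.div_add_mod (t + β - 1) β
  have := Nat.mod_lt (t + β - 1) hβ
  refine ⟨β * c, Fin.ofNat 8 (8 - c % 8), by rw [hc]; omega, by rw [hc]; omega, ?_⟩
  rw [mul_comm _ β, mul_comm _ β, ← mul_add]
  refine mul_dvd_mul_left β ?_
  simp only [Fin.ofNat]
  omega

/-- Blocks of length `8 * (2 * D) ^ k`, with a shift by `o` eighths of this length, where
`p = (k, o)`. -/
def scaledBlock (D : ℕ) (p : Fin (Nat.log (2 * D) n + 1) × Fin 8) : Fin n → Fin n :=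
  shiftedBlock ((2 * D) ^ (p.1 : ℕ)) p.2

-- The length of the window is within a factor `2 * D` of a scale `4 * (2 * D) ^ k`, and one of the
-- shifts has a boundary of blocks early in the window.
theorem Window.exists_challenging_scaledBlock {D : ℕ} (hD : 0 < D) (W : Window n) :
    ∃ p, W.Challenging D (scaledBlock D p) := by
  have hlen : W.len ≤ n := (Nat.le_add_left _ _).trans W.le_length
  obtain ⟨k, hk⟩ : ∃ k, k = Nat.log (2 * D) (W.len / 4) := ⟨_, rfl⟩
  have hkn : k < Nat.log (2 * D) n + 1 :=
    hk ▸ Nat.lt_succ_of_le (Nat.log_mono_right ((Nat.div_le_self _ _).trans hlen))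
  have scale_le : (2 * D) ^ k = 1 ∨ 4 * (2 * D) ^ k ≤ W.len := by
    rcases Nat.eq_zero_or_pos (W.len / 4) with h | h
    · simp [hk, h]
    · have := Nat.pow_log_le_self (2 * D) h.ne'
      rw [← hk] at this
      omega
  have lt_scale : W.len < 8 * (2 * D) ^ k * D := by
    have := Nat.lt_pow_succ_log_self (by omega : 1 < 2 * D) (W.len / 4)
    rw [← hk, pow_succ] at this
    have : W.len < 4 * ((2 * D) ^ k * (2 * D)) := by omega
    linarith
  have hβ : 0 < (2 * D) ^ k := by positivity
  obtain ⟨τ, o, hstart, hτ, hboundary⟩ := exists_boundary hβ W.start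
  have hquarter : 4 * (τ - W.start) ≤ W.len := by omega
  have hend : W.start + W.len ≤ τ + 8 * (2 * D) ^ k * D := by omega
  exact ⟨(⟨k, hkn⟩, o), W.challenging_shiftedBlock hβ hboundary hstart hquarter hend⟩

end Scales

section HardClasses

theorem exists_modelClass_forall_isNonAdaptive (n : ℕ) {D m : ℕ} (hD : 0 < D) (hm : 2 ^ D ≤ m) :
    ∃ C : ModelClass, C.HasSize m ∧ ∀ A : Learner.{u} C n, A.IsNonAdaptive →
      ∃ z, 1 / (64 * (Nat.log (2 * D) n + 1)) ≤ A.expectedExcessRisk z := by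
  obtain ⟨T, hT, hTD, rfl⟩ := exists_superset_comparators (σ := Unit) (by simpa using hm)
  refine ⟨channelClass T hT, hasSize_channelClass T hT, fun A hA => ?_⟩
  obtain ⟨z, hz⟩ := A.exists_le_expectedExcessRisk_of_challenging hD hTD
    (blk := fun p _ => scaledBlock D p) (fun _ _ => monotone_shiftedBlock _ _) fun ω B => by
      let z₀ (_ : Fin n) : (channelClass T hT).Z := (fun _ => 0, fun _ => false)
      obtain ⟨p, hp⟩ := (A.window ω z₀).exists_challenging_scaledBlock hD
      exact ⟨p, (), hA ω z₀ _ ▸ hp⟩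
  refine ⟨z, le_of_eq_of_le ?_ hz⟩
  simp only [Fintype.card_unit, Fintype.card_prod, Fintype.card_fin]
  push_cast
  ring

theorem exists_modelClass_forall_learner (n : ℕ) {D m : ℕ} (hD : 0 < D)
    (hm : 2 ^ (D + 16 * (Nat.log (2 * D) n + 1)) ≤ m) :
    ∃ C : ModelClass, C.HasSize m ∧ ∀ A : Learner.{u} C n,
      ∃ z, 1 / (64 * (Nat.log (2 * D) n + 1)) ≤ A.expectedExcessRisk z := by
  let σ : Type := Fin (Nat.log (2 * D) n + 1) × Fin 8
  have card_channels : Fintype.card σ = 8 * (Nat.log (2 * D) n + 1) := by simp [σ, mul_comm]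
  have card_le : Fintype.card σ * (2 ^ D * 2 ^ (Fintype.card σ - 1)) ≤ m := calc
    Fintype.card σ * (2 ^ D * 2 ^ (Fintype.card σ - 1))
      ≤ 2 ^ Fintype.card σ * (2 ^ D * 2 ^ Fintype.card σ) :=
        Nat.mul_le_mul Nat.lt_two_pow_self.le
          (Nat.mul_le_mul_left _ (Nat.pow_le_pow_right two_pos (Nat.sub_le _ _)))
    _ = 2 ^ (D + 16 * (Nat.log (2 * D) n + 1)) := by
        rw [← pow_add, ← pow_add, card_channels]
        congr 1
        ring
    _ ≤ m := hm
  obtain ⟨T, hT, hTD, rfl⟩ := exists_superset_comparators card_le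
  refine ⟨channelClass T hT, hasSize_channelClass T hT, fun A => ?_⟩
  obtain ⟨z, hz⟩ := A.exists_le_expectedExcessRisk_of_challenging hD hTD
    (blk := fun (_ : Unit) p => scaledBlock D p) (fun _ _ => monotone_shiftedBlock _ _)
    fun ω B => ⟨(), (A.window ω _).exists_challenging_scaledBlock hD⟩
  refine ⟨z, le_of_eq_of_le ?_ hz⟩
  rw [card_channels, Fintype.card_unit]
  push_cast
  ring

theorem Window.challenging_min {n : ℕ} (W : Window n) :
    W.Challenging 1 (fun i => min i ⟨W.start, W.start_lt⟩) := by
  have min_pos (i : Fin W.len) : min (W.pos i) ⟨W.start, W.start_lt⟩ = ⟨W.start, W.start_lt⟩ :=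
    min_eq_right (by simp [Fin.le_def])
  refine ⟨Finset.univ, by simp, fun i _ hi => ?_,
    fun i _ j _ _ => (min_pos i).trans (min_pos j).symm⟩
  obtain ⟨j, hj, hji⟩ := Finset.mem_image.1 hi
  have hj : (j : ℕ) < W.start := by simpa using hj
  exact (min_eq_right_iff.1 (hji.trans (min_pos i))).not_gt hj

-- A learner that sees fair coin flips cannot know that they are replaced by copies of a single coin
-- flip as soon as it stops.
theorem exists_modelClass_forall_learner_of_two_le (n : ℕ) {m : ℕ} (hm : 2 ≤ m) :
    ∃ C : ModelClass, C.HasSize m ∧ ∀ A : Learner.{u} C n,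
      ∃ z, 1 / (8 * n) ≤ A.expectedExcessRisk z := by
  obtain ⟨T, hT, hTD, rfl⟩ := exists_superset_comparators (σ := Unit) (D := 1) (by simpa using hm)
  refine ⟨channelClass T hT, hasSize_channelClass T hT, fun A => ?_⟩
  obtain ⟨z, hz⟩ := A.exists_le_expectedExcessRisk_of_challenging one_pos hTD
    (blk := fun k _ i => min i k) (fun _ _ _ _ hij => min_le_min_right _ hij) fun ω B => by
      let W := A.window ω (blockData 1 (fun _ => id) B)
      have same_window : A.window ω (blockData 1 (fun _ i => min i ⟨W.start, W.start_lt⟩) B) = W :=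
        (A.online ω _ _ fun i hi => by
          simp [blockData, Nat.mod_one, min_eq_left (a := i) (b := ⟨W.start, W.start_lt⟩) hi.le]).1
      exact ⟨⟨W.start, W.start_lt⟩, (), same_window.symm ▸ W.challenging_min⟩
  refine ⟨z, le_of_eq_of_le ?_ hz⟩
  simp

theorem Algorithm.HasHardInstance.mono {n m : ℕ} {A : Algorithm.{u} n} {r r' : ℝ}
    (h : A.HasHardInstance m r) (hr : r' ≤ r) : A.HasHardInstance m r' :=
  let ⟨C, hC, z, hz⟩ := h
  ⟨C, hC, z, hr.trans hz⟩

end HardClasses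

section Rate

variable {n m : ℕ}

theorem rate_le_one (n m : ℕ) : rate n m ≤ 1 := by
  unfold rate
  split_ifs
  · exact le_rfl
  · exact min_le_right _ _

theorem rate_nonneg (n m : ℕ) : 0 ≤ rate n m := by
  unfold rate
  split_ifs
  · exact zero_le_one
  · have := Real.log_natCast_nonneg n
    positivity

theorem rate_mul_log_le (n m : ℕ) : rate n m * Real.log n ≤ max 1 (Real.log (Real.log m)) := by
  unfold rate
  split_ifs with h
  · simp [h]
  · rcases (Real.log_natCast_nonneg n).eq_or_lt with h₀ | h₀
    · simp [← h₀]
    · exact (le_div_iff₀ h₀).1 (min_le_left _ _)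

theorem rate_mul_natLog_add_one_le {r : ℕ} (hr : 2 ≤ r) (hm : Real.log m ≤ r) :
    rate n m * (Nat.log r n + 1) ≤ 3 := by
  have one_le : 1 ≤ 2 * Real.log r := by
    have := Real.log_le_log two_pos (Nat.cast_le (α := ℝ).2 hr)
    have := Real.log_two_gt_d9
    linarith
  have loglog_le : Real.log (Real.log m) ≤ 2 * Real.log r := by
    rcases (Real.log_natCast_nonneg m).eq_or_lt with h₀ | h₀
    · rw [← h₀, Real.log_zero]
      linarith
    · linarith [Real.log_le_log h₀ hm]
  have natLog_mul_le : Nat.log r n * Real.log r ≤ Real.log n :=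
    (le_div_iff₀ (by linarith)).1 (Real.natLog_le_logb n r)
  have rate_mul_natLog_le : rate n m * Nat.log r n ≤ 2 := by
    refine le_of_mul_le_mul_right ?_ (by linarith : 0 < Real.log r)
    calc rate n m * Nat.log r n * Real.log r = rate n m * (Nat.log r n * Real.log r) := mul_assoc ..
      _ ≤ rate n m * Real.log n := mul_le_mul_of_nonneg_left natLog_mul_le (rate_nonneg n m)
      _ ≤ max 1 (Real.log (Real.log m)) := rate_mul_log_le n m
      _ ≤ 2 * Real.log r := max_le one_le loglog_le
  linarith [rate_le_one n m]

theorem mul_rate_le_one_div {D : ℕ} (hD : 0 < D) (hm : Real.log m ≤ 2 * D) :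
    1 / 192 * rate n m ≤ 1 / (64 * (Nat.log (2 * D) n + 1)) := by
  have := rate_mul_natLog_add_one_le (n := n) (r := 2 * D) (by omega) (by exact_mod_cast hm)
  rw [le_div_iff₀ (by positivity)]
  linarith

theorem Algorithm.IsNonAdaptive.hasHardInstance {A : Algorithm.{u} n} (hA : A.IsNonAdaptive)
    (hm : 2 ≤ m) : A.HasHardInstance m (1 / 192 * rate n m) := by
  have hD : 0 < Nat.log 2 m := Nat.log_pos one_lt_two hm
  obtain ⟨C, hC, hard⟩ :=
    exists_modelClass_forall_isNonAdaptive n hD (Nat.pow_log_le_self 2 (by omega))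
  have log_le : Real.log m ≤ 2 * Nat.log 2 m := calc
    Real.log m ≤ Real.log (2 ^ (Nat.log 2 m + 1)) :=
      Real.log_le_log (by positivity) (mod_cast (Nat.lt_pow_succ_log_self one_lt_two m).le)
    _ = (Nat.log 2 m + 1 : ℕ) * Real.log 2 := Real.log_pow _ _
    _ ≤ (Nat.log 2 m + 1 : ℕ) * 1 := by
      gcongr
      linarith [Real.log_two_lt_d9]
    _ ≤ 2 * Nat.log 2 m := by
      norm_cast
      omega
  exact HasHardInstance.mono ⟨C, hC, hard (A C) (hA C)⟩ (mul_rate_le_one_div hD log_le)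

theorem two_pow_le_of_mul_log_le {D : ℕ} (le_D : Real.log m ≤ 2 * D)
    (D_le : D ≤ Real.log m / 2 + 1) (hm : 40 ≤ Real.log m)
    (hnm : 32 * Real.log n ≤ Real.log m * Real.log (Real.log m)) :
    2 ^ (D + 16 * (Nat.log (2 * D) n + 1)) ≤ m := by
  have loglog_pos : 0 < Real.log (Real.log m) := Real.log_pos (by linarith)
  have loglog_le : Real.log (Real.log m) ≤ Real.log (2 * D : ℕ) :=
    Real.log_le_log (by linarith) (mod_cast le_D)
  have natLog_le : (Nat.log (2 * D) n : ℝ) ≤ Real.log m / 32 := calc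
    (Nat.log (2 * D) n : ℝ) ≤ Real.log n / Real.log (2 * D : ℕ) := Real.natLog_le_logb n _
    _ ≤ Real.log n / Real.log (Real.log m) := by gcongr
    _ ≤ Real.log m / 32 := by
      rw [div_le_div_iff₀ loglog_pos (by norm_num)]
      linarith
  have exponent_le : (D + 16 * (Nat.log (2 * D) n + 1) : ℝ) ≤ Real.log m + 17 := by linarith
  have log_le : Real.log ((2 ^ (D + 16 * (Nat.log (2 * D) n + 1)) : ℕ) : ℝ) ≤ Real.log m := by
    push_cast
    rw [Real.log_pow]
    push_cast
    calc (D + 16 * (Nat.log (2 * D) n + 1) : ℝ) * Real.log 2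
        ≤ (Real.log m + 17) * 0.7 := by
          gcongr
          linarith [Real.log_two_lt_d9]
      _ ≤ Real.log m := by linarith
  have m_pos : (0 : ℝ) < m :=
    zero_lt_one.trans ((Real.log_pos_iff m.cast_nonneg).1 (by linarith))
  exact_mod_cast (Real.log_le_log_iff (by positivity) m_pos).1 log_le

theorem mul_log_le_mul_log {x y : ℝ} (hx : 4 ≤ x) (h : 64 * x ≤ y * Real.log x) :
    40 ≤ y ∧ 32 * x ≤ y * Real.log y := by
  have log_pos : 0 < Real.log x := Real.log_pos (by linarith)
  have two_le_sqrt : 2 ≤ √x := Real.le_sqrt_of_sq_le (by linarith)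
  have log_sqrt : Real.log √x = Real.log x / 2 := Real.log_sqrt (by linarith)
  have sqrt_le : 32 * √x ≤ y := by
    have log_le : Real.log x ≤ 2 * √x := by
      linarith [Real.log_le_self (Real.sqrt_nonneg x)]
    refine le_of_mul_le_mul_right ?_ log_pos
    calc 32 * √x * Real.log x ≤ 32 * √x * (2 * √x) := by gcongr
      _ = 64 * (√x * √x) := by ring
      _ = 64 * x := by rw [Real.mul_self_sqrt (by linarith)]
      _ ≤ y * Real.log x := h
  have log_le : Real.log x / 2 ≤ Real.log y :=
    log_sqrt ▸ Real.log_le_log (by linarith) (by linarith)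
  refine ⟨by linarith, ?_⟩
  calc 32 * x ≤ y * (Real.log x / 2) := by linarith
    _ ≤ y * Real.log y := mul_le_mul_of_nonneg_left log_le (by linarith)

theorem Algorithm.hasHardInstance_of_mul_log_le (A : Algorithm.{u} n) (hn : 4 ≤ Real.log n)
    (hnm : 64 * Real.log n ≤ Real.log m * Real.log (Real.log n)) :
    A.HasHardInstance m (1 / 192 * rate n m) := by
  obtain ⟨hm, hnm⟩ := mul_log_le_mul_log hn hnm
  have hD : 0 < ⌈Real.log m / 2⌉₊ := Nat.ceil_pos.2 (by linarith)
  have le_D : Real.log m ≤ 2 * ⌈Real.log m / 2⌉₊ := by linarith [Nat.le_ceil (Real.log m / 2)]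
  have D_le : (⌈Real.log m / 2⌉₊ : ℝ) ≤ Real.log m / 2 + 1 :=
    (Nat.ceil_lt_add_one (by linarith)).le
  obtain ⟨C, hC, hard⟩ :=
    exists_modelClass_forall_learner n hD (two_pow_le_of_mul_log_le le_D D_le hm hnm)
  exact HasHardInstance.mono ⟨C, hC, hard (A C)⟩ (mul_rate_le_one_div hD le_D)

theorem Algorithm.hasHardInstance_of_rpow_le (A : Algorithm.{u} n) {a : ℝ} (hn : 4 ≤ Real.log n)
    (ha : 64 ≤ a * Real.log (Real.log n)) (hm : (n : ℝ) ^ a ≤ m) :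
    A.HasHardInstance m (1 / 192 * rate n m) := by
  have n_pos : (0 : ℝ) < n :=
    zero_lt_one.trans ((Real.log_pos_iff n.cast_nonneg).1 (by linarith))
  have log_le : a * Real.log n ≤ Real.log m :=
    Real.log_rpow n_pos a ▸ Real.log_le_log (Real.rpow_pos_of_pos n_pos a) hm
  have loglog_pos : 0 < Real.log (Real.log n) := Real.log_pos (by linarith)
  refine A.hasHardInstance_of_mul_log_le hn ?_
  calc 64 * Real.log n ≤ a * Real.log (Real.log n) * Real.log n := by gcongr
    _ = a * Real.log n * Real.log (Real.log n) := by ring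
    _ ≤ Real.log m * Real.log (Real.log n) := by gcongr

theorem Algorithm.hasHardInstance_one_div (A : Algorithm.{u} n) (hm : 2 ≤ m) :
    A.HasHardInstance m (1 / (8 * n)) :=
  let ⟨C, hC, hard⟩ := exists_modelClass_forall_learner_of_two_le n hm
  ⟨C, hC, hard (A C)⟩

theorem eventually_le_mul_loglog {g : ℕ → ℝ}
    (hg : Tendsto (fun n : ℕ => g n / Real.log (Real.log n)) atTop atTop) (b : ℝ) :
    ∀ᶠ n : ℕ in atTop, b ≤ g n * Real.log (Real.log n) := by
  have loglog_atTop : Tendsto (fun n : ℕ => Real.log (Real.log n)) atTop atTop :=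
    Real.tendsto_log_atTop.comp (Real.tendsto_log_atTop.comp tendsto_natCast_atTop_atTop)
  filter_upwards [loglog_atTop.eventually_ge_atTop 1, hg.eventually_ge_atTop |b|] with n hloglog hgn
  rw [le_div_iff₀ (by linarith)] at hgn
  have abs_le : |b| ≤ g n := (le_mul_of_one_le_right (abs_nonneg b) hloglog).trans hgn
  calc b ≤ |b| := le_abs_self b
    _ ≤ g n := abs_le
    _ ≤ g n * Real.log (Real.log n) :=
      le_mul_of_one_le_right ((abs_nonneg b).trans abs_le) hloglog

end Rate

end SelectiveLearning

theorem theorem2_general :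
    ∃ c : ℝ, 0 < c ∧
      (∀ n m : ℕ, 2 ≤ m → ∀ A : SelectiveLearning.Algorithm.{u} n, A.IsNonAdaptive →
        A.HasHardInstance m (c * SelectiveLearning.rate n m)) ∧
      (∀ g : ℕ → ℝ, (∀ᶠ n : ℕ in atTop, 64 ≤ g n * Real.log (Real.log n)) →
        (∃ n₀ : ℕ, ∀ n m : ℕ, n₀ ≤ n → (n : ℝ) ^ g n ≤ m →
          ∀ A : SelectiveLearning.Algorithm.{u} n,
            A.HasHardInstance m (c * SelectiveLearning.rate n m)) ∧
        (∃ c' : ℝ, 0 < c' ∧ ∀ n m : ℕ, 1 ≤ n → 2 ≤ m → (n : ℝ) ^ g n ≤ m →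
          ∀ A : SelectiveLearning.Algorithm.{u} n,
            A.HasHardInstance m (c' * SelectiveLearning.rate n m))) := by
  refine ⟨1 / 192, by norm_num, fun n m hm A hA => hA.hasHardInstance hm, fun g hg => ?_⟩
  have eventually_log_ge : ∀ᶠ n : ℕ in atTop, 4 ≤ Real.log n :=
    (Real.tendsto_log_atTop.comp tendsto_natCast_atTop_atTop).eventually_ge_atTop 4
  obtain ⟨n₀, hn₀⟩ := eventually_atTop.1 (eventually_log_ge.and hg)
  have hard_of_le (n m : ℕ) (hn : n₀ ≤ n) (hm : (n : ℝ) ^ g n ≤ m)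
      (A : SelectiveLearning.Algorithm.{u} n) :
      A.HasHardInstance m (1 / 192 * SelectiveLearning.rate n m) :=
    A.hasHardInstance_of_rpow_le (hn₀ n hn).1 (hn₀ n hn).2 hm
  refine ⟨⟨n₀, hard_of_le⟩, min (1 / 192) (1 / (8 * (n₀ + 1))), by positivity,
    fun n m hn hm hnm A => ?_⟩
  rcases le_total n₀ n with h | h
  · exact (hard_of_le n m h hnm A).mono
      (mul_le_mul_of_nonneg_right (min_le_left _ _) (SelectiveLearning.rate_nonneg n m))
  · refine (A.hasHardInstance_one_div hm).mono ?_
    calc min (1 / 192) (1 / (8 * (n₀ + 1) : ℝ)) * SelectiveLearning.rate n m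
        ≤ 1 / (8 * (n₀ + 1)) * 1 := by
          gcongr
          exacts [SelectiveLearning.rate_nonneg n m, min_le_right _ _,
            SelectiveLearning.rate_le_one n m]
      _ ≤ 1 / (8 * n) := by
          rw [mul_one]
          gcongr
          exact_mod_cast h.trans n₀.le_succ

theorem theorem2 :
    ∃ c : ℝ, 0 < c ∧
      -- non-adaptive algorithms
      (∀ n m : ℕ, 1 ≤ n → 2 ≤ m → ∀ A : SelectiveLearning.Algorithm.{u} n, A.IsNonAdaptive →
        A.HasHardInstance m (c * SelectiveLearning.rate n m)) ∧
      -- arbitrary algorithms, for `m ≥ n ^ g n` with `g n = ω(log log n)`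
      (∀ g : ℕ → ℝ,
        Tendsto (fun n : ℕ => g n / Real.log (Real.log (n : ℝ))) atTop atTop →
          (∃ n₀ : ℕ, ∀ n m : ℕ, n₀ ≤ n → 1 ≤ n → 2 ≤ m → (n : ℝ) ^ g n ≤ (m : ℝ) →
            ∀ A : SelectiveLearning.Algorithm.{u} n,
              A.HasHardInstance m (c * SelectiveLearning.rate n m)) ∧
          (∃ c' : ℝ, 0 < c' ∧ ∀ n m : ℕ, 1 ≤ n → 2 ≤ m → (n : ℝ) ^ g n ≤ (m : ℝ) →
            ∀ A : SelectiveLearning.Algorithm.{u} n,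
              A.HasHardInstance m (c' * SelectiveLearning.rate n m))) := by
  obtain ⟨c, hc, nonadaptive, adaptive⟩ := theorem2_general.{u}
  refine ⟨c, hc, fun n m _ => nonadaptive n m, fun g hg => ?_⟩
  exact (adaptive g (SelectiveLearning.eventually_le_mul_loglog hg 64)).imp_left
    fun ⟨n₀, hard⟩ => ⟨n₀, fun n m hn _ _ => hard n m hn⟩
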